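/- For a finite group $G$, the commuting probability of $G$ is \[P(G)=\frac{|\{(g,h)\in G\times G : gh=hg\}|}{|G|^2},\] and let $S=\{P(G) : G \text{ a finite group}\}\subseteq(0,1]$. Then the following hold. (a) Let $(G_i)_{i=1}^\infty$ be a sequence of finite groups whose commuting probabilities are bounded away from zero, i.e. there is $\varepsilon>0$ with $P(G_i)\geq\varepsilon$ for all $i$. Then there exist a finite group $H$ and a subsequence $(G_{n_i})_{i=1}^\infty$ such that $P(G_{n_i})\to P(H)$ as $i\to\infty$ and $P(G_{n_i})\geq P(H)$ for all $i$. (b) The set $S\cup\{0\}$ is a closed subset of $\mathbb{R}$. (c) (Joseph's three conjectures.) Let $(x_i)_{i=1}^\infty$ be a sequence of elements of $S$ converging to a real number $\ell>0$. Then (1) $\ell\in\mathbb{Q}$; (2) $x_i\geq\ell$ for all but finitely many $i$; and (3) $\ell\in S$. -/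

import Mathlib

/-- The set `S` of all commuting probabilities of finite groups, as a set of real numbers.
(Every finite group is isomorphic to one whose underlying type lives in `Type`.) -/
def commutingProbabilities : Set ℝ :=
  {x | ∃ (G : Type) (_ : Group G) (_ : Finite G), x = (commProb G : ℝ)}

/-! Suppose P(G) ≥ 1/k for every G in a sequence. By averaging, the elements with at most n ≥ 2k
conjugates have density at least 1/(2k), so they generate a subgroup D of bounded index whose own
classes are bounded (`closure_subset_pow_of_card_lt`). For a suitable n the classes outside D grow
without bound along the sequence, so P(G) is close to P(D)/[G:D]².

By Neumann's theorem |D'| is bounded. Among normal subgroups W of bounded index in D that centralize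
D', take one with L = [W,W] smallest. Minimality forces x ↦ [x,y] to hit all of L for most y, so
P(D) is close to P(D/L)/|L|. The center of D/L has bounded index, so P(D/L) takes only finitely many
values.

Thus v = P(D/L)/(|L|[G:D]²) is constant on a large set of indices. It is always at most P(G), and it
is a commuting probability because P is multiplicative and every 1/n is attained. The extremal
choices are made along an ultrafilter, where a bounded natural number is eventually constant;
subsequences appear only at the end. -/

open scoped Pointwise commutatorElement

/-! ### Counting commuting pairs -/

section Counting

variable {G : Type*} [Group G]

theorem card_centralizer_singleton_eq_sum [Fintype G] (x : G) :
    Nat.card (Subgroup.centralizer {x}) = ∑ y : G, open Classical in if Commute x y then 1 else 0 := by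
  classical
  rw [Finset.sum_boole, Nat.cast_id, Nat.card_eq_fintype_card, Fintype.card_subtype]
  congr 1
  ext y
  simp [Subgroup.mem_centralizer_singleton_iff, commute_iff_eq, eq_comm]

theorem card_commute_eq_sum (M : Type*) [Mul M] [Fintype M] :
    Nat.card {p : M × M // Commute p.1 p.2} =
      ∑ x : M, ∑ y : M, open Classical in if Commute x y then 1 else 0 := by
  classical
  rw [← Fintype.sum_prod_type', Finset.sum_boole, Nat.cast_id, Nat.card_eq_fintype_card,
    Fintype.card_subtype]

theorem commProb_mul_card_sq (M : Type*) [Mul M] [Fintype M] [Nonempty M] :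
    commProb M * (Nat.card M : ℚ) ^ 2 =
      ∑ x : M, ∑ y : M, open Classical in if Commute x y then 1 else 0 := by
  have h : (Nat.card M : ℚ) ^ 2 ≠ 0 := by simp
  rw [commProb_def, div_mul_cancel₀ _ h, card_commute_eq_sum]
  push_cast
  rfl

theorem sum_quotient_mk [Fintype G] (L : Subgroup G) [Fintype (G ⧸ L)] {A : Type*}
    [CommSemiring A] (f : G ⧸ L → A) :
    ∑ x : G, f (x : G ⧸ L) = (Nat.card L : A) * ∑ a, f a := by
  classical
  rw [← Finset.sum_fiberwise (s := Finset.univ) (g := fun x : G => (x : G ⧸ L)), Finset.mul_sum]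
  refine Finset.sum_congr rfl fun a _ => ?_
  rw [Finset.sum_congr rfl (g := fun _ => f a) (by simp +contextual), Finset.sum_const,
    nsmul_eq_mul]
  congr 2
  have := QuotientGroup.card_preimage_mk L {a}
  rw [Nat.card_eq_fintype_card, Fintype.card_subtype] at this
  simpa using this

theorem sum_card_centralizer [Fintype G] :
    ∑ x : G, (Nat.card (Subgroup.centralizer {x}) : ℚ) = commProb G * (Nat.card G : ℚ) ^ 2 := by
  rw [commProb_mul_card_sq]
  refine Finset.sum_congr rfl fun x _ => ?_
  rw [card_centralizer_singleton_eq_sum]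
  push_cast
  rfl

theorem card_centralizer_eq_div [Finite G] (x : G) :
    (Nat.card (Subgroup.centralizer {x}) : ℚ) =
      (Nat.card G : ℚ) / (Subgroup.centralizer {x}).index := by
  rw [eq_div_iff (by simpa using Subgroup.index_ne_zero_of_finite)]
  exact_mod_cast (Subgroup.centralizer {x}).card_mul_index

/-- Commuting depends only on cosets of the center. Hence a bound on the index of the center leaves
finitely many values of the commuting probability. -/
theorem commProb_mul_index_center_sq [Finite G] :
    ∃ n : ℕ, n ≤ (Subgroup.center G).index ^ 2 ∧
      commProb G * ((Subgroup.center G).index : ℚ) ^ 2 = n := by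
  classical
  have := Fintype.ofFinite G
  have := Fintype.ofFinite (G ⧸ Subgroup.center G)
  set Z := Subgroup.center G
  have key : ∀ x y : G, Commute x y ↔ Commute (x : G ⧸ Z).out (y : G ⧸ Z).out := by
    intro x y
    obtain ⟨⟨u, hu⟩, hx⟩ := QuotientGroup.mk_out_eq_mul Z x
    obtain ⟨⟨v, hv⟩, hy⟩ := QuotientGroup.mk_out_eq_mul Z y
    have hu' := Subgroup.mem_center_iff.1 hu
    have hv' := Subgroup.mem_center_iff.1 hv
    rw [hx, hy]
    have hu : ∀ g, Commute g u := hu'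
    have hv : ∀ g, Commute g v := hv'
    constructor
    · intro h
      exact ((h.mul_right (hv x))).mul_left (hu _).symm
    · intro h
      have := (h.mul_left ((hu (y * v)).symm.inv_left)).mul_right (hv _).inv_right
      simpa using this
  refine ⟨∑ a : G ⧸ Z, ∑ b : G ⧸ Z, if Commute a.out b.out then 1 else 0, ?_, ?_⟩
  · calc _ ≤ ∑ a : G ⧸ Z, ∑ b : G ⧸ Z, 1 := by
          gcongr; split_ifs <;> simp
      _ = _ := by simp [Subgroup.index, sq, Nat.card_eq_fintype_card]
  · have h := commProb_mul_card_sq G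
    have h' : ∑ x : G, ∑ y : G, (if Commute x y then (1 : ℚ) else 0) =
        ∑ x : G, ∑ y : G, if Commute (x : G ⧸ Z).out (y : G ⧸ Z).out then (1 : ℚ) else 0 :=
      Finset.sum_congr rfl fun x _ => Finset.sum_congr rfl fun y _ => if_congr (key x y) rfl rfl
    rw [h'] at h
    simp_rw [fun x : G => sum_quotient_mk Z
      (fun b => if Commute (x : G ⧸ Z).out b.out then (1 : ℚ) else 0)] at h
    rw [sum_quotient_mk Z (fun a => (Nat.card Z : ℚ) *
      ∑ b : G ⧸ Z, if Commute (Quotient.out a) (Quotient.out b) then (1 : ℚ) else 0),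
      ← Finset.mul_sum] at h
    have hZ : (Nat.card Z : ℚ) ≠ 0 := by simp
    have hc : (Nat.card G : ℚ) = Nat.card Z * Z.index := by exact_mod_cast Z.card_mul_index.symm
    rw [hc] at h
    push_cast
    apply mul_left_cancel₀ (pow_ne_zero 2 hZ)
    linear_combination h

/-- Pairs with a member outside `D` contribute little to `commProb G` when the elements outside
`D` have large conjugacy classes. -/
theorem commProb_le_of_le_index_centralizer [Finite G] (D : Subgroup G) {k : ℕ} (hk : 0 < k)
    (hD : ∀ x ∉ D, k ≤ (Subgroup.centralizer {x}).index) :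
    commProb G ≤ commProb D / (D.index : ℚ) ^ 2 + 2 / k := by
  classical
  have := Fintype.ofFinite G
  have hn : (0 : ℚ) < Nat.card G := by exact_mod_cast Nat.card_pos
  have hout : ∑ x : G, ∑ y : G, (if x ∉ D ∧ Commute x y then (1 : ℚ) else 0) ≤
      (Nat.card G : ℚ) ^ 2 / k := by
    calc _ ≤ ∑ x : G, (Nat.card G : ℚ) / k := by
          refine Finset.sum_le_sum fun x _ => ?_
          by_cases hx : x ∈ D
          · simpa [hx] using by positivity
          · have h1 := card_centralizer_eq_div x
            rw [card_centralizer_singleton_eq_sum] at h1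
            push_cast at h1
            simp only [hx, not_false_eq_true, true_and]
            refine le_trans (le_of_eq (by convert h1)) ?_
            have : (0 : ℚ) < k := by exact_mod_cast hk
            gcongr
            exact hD x hx
      _ = _ := by
          rw [Finset.sum_const, Finset.card_univ, nsmul_eq_mul, ← Nat.card_eq_fintype_card]
          ring
  have hin : ∑ x : G, ∑ y : G, (if x ∈ D ∧ y ∈ D ∧ Commute x y then (1 : ℚ) else 0) =
      commProb D * (Nat.card D : ℚ) ^ 2 := by
    rw [commProb_mul_card_sq]
    have e1 : ∀ f : G → ℚ, ∑ x : G, (if x ∈ D then f x else 0) = ∑ x : D, f x := by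
      intro f
      rw [← Finset.sum_filter]
      exact (Finset.sum_subtype _ (by simp) f)
    simp_rw [ite_and]
    refine Eq.trans ?_ ((e1 fun x => ∑ y : D, if Commute x (y : G) then (1 : ℚ) else 0).trans ?_)
    · refine Finset.sum_congr rfl fun x _ => ?_
      split_ifs
      · exact e1 fun y => if Commute x y then (1 : ℚ) else 0
      · simp
    · refine Finset.sum_congr rfl fun x _ => Finset.sum_congr rfl fun y _ => ?_
      congr 1
      simp [commute_iff_eq, Subtype.ext_iff]
  have h := commProb_mul_card_sq G
  have hle : commProb G * (Nat.card G : ℚ) ^ 2 ≤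
      commProb D * (Nat.card D : ℚ) ^ 2 + (Nat.card G : ℚ) ^ 2 / k +
        (Nat.card G : ℚ) ^ 2 / k := by
    rw [h, ← hin]
    -- A commuting pair lies in D × D, or its first or its second entry is outside D; the last two
    -- cases are symmetric, whence the factor 2.
    refine le_trans ?_ (add_le_add (add_le_add le_rfl hout) (Finset.sum_comm.trans_le hout))
    simp_rw [← Finset.sum_add_distrib]
    refine Finset.sum_le_sum fun x _ => Finset.sum_le_sum fun y _ => ?_
    by_cases h1 : x ∈ D <;> by_cases h2 : y ∈ D <;> by_cases h3 : Commute x y <;>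
      simp [h1, h2, h3, Commute.symm_iff (a := y)]
  have hi : (D.index : ℚ) ≠ 0 := by simpa using Subgroup.index_ne_zero_of_finite
  have hd : (Nat.card D : ℚ) = Nat.card G / D.index := by
    rw [eq_div_iff hi]; exact_mod_cast D.card_mul_index
  have hk' : (0 : ℚ) < k := by exact_mod_cast hk
  rw [hd] at hle
  have : commProb G * (Nat.card G : ℚ) ^ 2 ≤
      (commProb D / (D.index : ℚ) ^ 2 + 2 / k) * (Nat.card G : ℚ) ^ 2 := by
    refine hle.trans (le_of_eq ?_)
    ring
  exact le_of_mul_le_mul_right this (by positivity)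

/-- The elements `y` for which some element of `L` is not of the form `⁅x, y⁆` control the
difference between `commProb G` and `commProb (G ⧸ L) / |L|`. -/
theorem commProb_le_commProb_quotient_add [Finite G] (L : Subgroup G) [L.Normal] :
    commProb G ≤ commProb (G ⧸ L) / Nat.card L +
      Nat.card {y : G | ¬ ∀ l ∈ L, ∃ x : G, ⁅x, y⁆ = l} / Nat.card G := by
  classical
  have := Fintype.ofFinite G
  have := Fintype.ofFinite (G ⧸ L)
  have hL : (0 : ℚ) < Nat.card L := by exact_mod_cast Nat.card_pos
  have hn : (0 : ℚ) < Nat.card G := by exact_mod_cast Nat.card_pos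
  -- The elements commuting with y modulo L contain |L| disjoint cosets of the centralizer of y, one
  -- for each value of ⁅x, y⁆ in L.
  have hgood : ∀ y : G, (∀ l ∈ L, ∃ x : G, ⁅x, y⁆ = l) →
      (Nat.card (Subgroup.centralizer {y}) : ℚ) ≤
        (∑ x : G, if Commute (y : G ⧸ L) (x : G ⧸ L) then (1 : ℚ) else 0) / Nat.card L := by
    intro y hy
    rw [le_div_iff₀ hL, Finset.sum_boole]
    norm_cast
    rw [mul_comm, ← Nat.card_prod, ← Fintype.card_subtype, ← Nat.card_eq_fintype_card]
    choose! s hs using hy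
    have key : ∀ (l : L) (c : Subgroup.centralizer {y}), ⁅s l * c, y⁆ = (l : G) := by
      intro l c
      have hc := Subgroup.mem_centralizer_singleton_iff.1 c.2
      have hl := hs l l.2
      rw [commutatorElement_def] at hl ⊢
      have : (c : G) * y * (c : G)⁻¹ = y := by rw [hc]; group
      calc _ = s l * (c * y * (c : G)⁻¹) * (s l)⁻¹ * y⁻¹ := by group
        _ = _ := by rw [this, hl]
    refine Nat.card_le_card_of_injective
      (fun p : L × Subgroup.centralizer {y} => ⟨s p.1 * p.2, ?_⟩) ?_
    · have h := key p.1 p.2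
      have h2 : ((⁅s p.1 * p.2, y⁆ : G) : G ⧸ L) = 1 := by
        rw [h]; exact (QuotientGroup.eq_one_iff _).2 p.1.2
      have h3 : ⁅((s p.1 * p.2 : G) : G ⧸ L), (y : G ⧸ L)⁆ = 1 := h2
      exact (commutatorElement_eq_one_iff_commute.1 h3).symm
    · rintro ⟨l, c⟩ ⟨l', c'⟩ h
      have h' : s l * c = s l' * (c' : G) := congrArg Subtype.val h
      have hl : l = l' := Subtype.ext (by rw [← key l c, ← key l' c', h'])
      subst hl
      rw [Subtype.ext (mul_left_cancel h')]
  have hsum : commProb G * (Nat.card G : ℚ) ^ 2 ≤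
      ∑ y : G, ((∑ x : G, if Commute (y : G ⧸ L) (x : G ⧸ L) then (1 : ℚ) else 0) / Nat.card L +
        if ¬ ∀ l ∈ L, ∃ x : G, ⁅x, y⁆ = l then (Nat.card G : ℚ) else 0) := by
    rw [← sum_card_centralizer]
    refine Finset.sum_le_sum fun y _ => ?_
    by_cases hy : ∀ l ∈ L, ∃ x : G, ⁅x, y⁆ = l
    · rw [if_neg (not_not.2 hy), add_zero]
      exact hgood y hy
    · rw [if_pos hy]
      have h1 : (Nat.card (Subgroup.centralizer {y}) : ℚ) ≤ Nat.card G := by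
        exact_mod_cast Subgroup.card_le_card_group _
      have h2 : (0 : ℚ) ≤ (∑ x : G, if Commute (y : G ⧸ L) (x : G ⧸ L) then (1 : ℚ) else 0) /
          Nat.card L := by
        refine div_nonneg (Finset.sum_nonneg fun _ _ => ?_) hL.le
        split_ifs <;> simp
      linarith
  rw [Finset.sum_add_distrib, ← Finset.sum_div, ← Finset.sum_filter, Finset.sum_const,
    nsmul_eq_mul] at hsum
  rw [Finset.sum_congr rfl fun (y : G) _ => sum_quotient_mk L
      (fun b => if Commute (y : G ⧸ L) b then (1 : ℚ) else 0)] at hsum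
  rw [sum_quotient_mk L (fun a => (Nat.card L : ℚ) *
      ∑ b : G ⧸ L, if Commute a b then (1 : ℚ) else 0),
      ← Finset.mul_sum] at hsum
  have hq := commProb_mul_card_sq (G ⧸ L)
  have hc : (Nat.card G : ℚ) = Nat.card L * Nat.card (G ⧸ L) := by
    exact_mod_cast L.card_mul_index.symm
  have hb : Nat.card {y : G | ¬ ∀ l ∈ L, ∃ x : G, ⁅x, y⁆ = l} =
      (Finset.univ.filter fun y : G => ¬ ∀ l ∈ L, ∃ x : G, ⁅x, y⁆ = l).card := by
    rw [Nat.card_eq_fintype_card, Fintype.card_subtype]; rfl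
  rw [hb]
  have hlast : commProb G * (Nat.card G : ℚ) ^ 2 ≤ (commProb (G ⧸ L) / Nat.card L +
      (Finset.univ.filter fun y : G => ¬ ∀ l ∈ L, ∃ x : G, ⁅x, y⁆ = l).card / Nat.card G) *
        (Nat.card G : ℚ) ^ 2 := by
    refine hsum.trans (le_of_eq ?_)
    rw [add_mul]
    congr 1
    · rw [← hq, hc]; field_simp
    · field_simp
  exact le_of_mul_le_mul_right hlast (by positivity)

end Counting

/-! ### Product growth and Neumann's theorem -/

section BoundedClasses

variable {G : Type*} [Group G]

/-- While powers of X still grow, pick y in X^(3t+2) outside X^(3t+1). Then yX is disjoint from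
X^(3t), and both lie in X^(3t+3). So every three steps add |X| elements, which cannot happen k
times. -/
theorem closure_subset_pow_of_card_lt [Finite G] {X : Set G} (h1 : 1 ∈ X) (hinv : X⁻¹ = X) {k : ℕ}
    (hk : Nat.card G < k * X.ncard) : (Subgroup.closure X : Set G) ⊆ X ^ (3 * k + 1) := by
  have key : ∀ t : ℕ, (∃ s ≤ 3 * t, X ^ (s + 2) ⊆ X ^ (s + 1)) ∨
      t * X.ncard ≤ (X ^ (3 * t)).ncard := by
    intro t
    induction t with
    | zero => right; simp
    | succ t ih =>
      rcases ih with ⟨s, hs, h⟩ | h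
      · exact Or.inl ⟨s, by omega, h⟩
      by_cases hsub : X ^ (3 * t + 2) ⊆ X ^ (3 * t + 1)
      · exact Or.inl ⟨3 * t, by omega, hsub⟩
      right
      obtain ⟨y, hy, hy'⟩ := Set.not_subset.1 hsub
      have hdisj : Disjoint (X ^ (3 * t)) (y • X) := by
        rw [Set.disjoint_left]
        rintro z hz ⟨x, hx, rfl⟩
        apply hy'
        have : y = (y • x) * x⁻¹ := by simp
        rw [this, pow_succ]
        exact Set.mul_mem_mul hz (by rwa [← Set.mem_inv, hinv])
      have hunion : X ^ (3 * t) ∪ y • X ⊆ X ^ (3 * (t + 1)) := by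
        apply Set.union_subset
        · exact Set.pow_subset_pow_right h1 (by omega)
        · rintro _ ⟨x, hx, rfl⟩
          rw [show 3 * (t + 1) = (3 * t + 2) + 1 by ring, pow_succ]
          exact Set.mul_mem_mul hy hx
      have := Set.ncard_le_ncard hunion (Set.toFinite _)
      rw [Set.ncard_union_eq hdisj (Set.toFinite _) (Set.toFinite _), Set.ncard_smul_set] at this
      linarith
  rcases key k with ⟨s, hs, h⟩ | h
  · intro g hg
    refine Set.pow_subset_pow_right h1 (show s + 1 ≤ 3 * k + 1 by omega) ?_
    induction hg using Subgroup.closure_induction_right with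
    | one => exact Set.one_mem_pow h1
    | mul_right x _ y hy ih => exact h (by rw [pow_succ]; exact Set.mul_mem_mul ih hy)
    | mul_inv_cancel x _ y hy ih =>
      exact h (by rw [pow_succ]; exact Set.mul_mem_mul ih (by rwa [← Set.mem_inv, hinv]))
  · have := Set.ncard_le_ncard (Set.subset_univ (X ^ (3 * k))) (Set.toFinite _)
    rw [Set.ncard_univ] at this
    omega

theorem index_centralizer_mul_le [Finite G] (x y : G) :
    (Subgroup.centralizer {x * y}).index ≤
      (Subgroup.centralizer {x}).index * (Subgroup.centralizer {y}).index := by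
  refine (Subgroup.index_antitone fun g hg => ?_).trans Subgroup.index_inf_le
  simp only [Subgroup.mem_inf, Subgroup.mem_centralizer_singleton_iff] at hg ⊢
  rw [← mul_assoc, hg.1, mul_assoc, hg.2, mul_assoc]

theorem index_centralizer_inv (x : G) :
    (Subgroup.centralizer {x⁻¹}).index = (Subgroup.centralizer {x}).index := by
  congr 1
  ext g
  simp only [Subgroup.mem_centralizer_singleton_iff]
  exact (Commute.inv_right_iff (a := g) (b := x))

theorem index_centralizer_le_pow_of_mem_pow [Finite G] {X : Set G} {n : ℕ}
    (hX : ∀ x ∈ X, (Subgroup.centralizer {x}).index ≤ n) (r : ℕ) :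
    ∀ x ∈ X ^ r, (Subgroup.centralizer {x}).index ≤ n ^ r := by
  induction r with
  | zero =>
    intro x hx
    rw [pow_zero, Set.mem_one] at hx
    subst hx
    have : Subgroup.centralizer {(1 : G)} = ⊤ := by
      ext; simp [Subgroup.mem_centralizer_singleton_iff]
    simp [this]
  | succ r ih =>
    rw [pow_succ]
    rintro _ ⟨x, hx, y, hy, rfl⟩
    exact (index_centralizer_mul_le x y).trans (Nat.mul_le_mul (ih x hx) (hX y hy))

theorem index_centralizer_le_pow_card [Finite G] {m : ℕ}
    (hm : ∀ x : G, (Subgroup.centralizer {x}).index ≤ m) (T : Set G) :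
    (Subgroup.centralizer T).index ≤ m ^ T.ncard := by
  have := Fintype.ofFinite T
  rw [Subgroup.centralizer_eq_iInf, iInf_subtype']
  refine (Subgroup.index_iInf_le _).trans ?_
  refine (Finset.prod_le_pow_card _ (fun x : T => (Subgroup.centralizer {(x : G)}).index) m
    fun x _ => hm (x : G)).trans ?_
  rw [Finset.card_univ, ← Nat.card_eq_fintype_card, Nat.card_coe_set_eq]

theorem mem_conjugatesOf_iff_exists {x y : G} : y ∈ conjugatesOf x ↔ ∃ c, c * x * c⁻¹ = y :=
  isConj_iff

theorem conjugatesOf_eq_range_out (x : G) :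
    conjugatesOf x =
      Set.range fun q : G ⧸ Subgroup.centralizer {x} => q.out * x * q.out⁻¹ := by
  ext y
  rw [mem_conjugatesOf_iff_exists, Set.mem_range]
  constructor
  · rintro ⟨c, rfl⟩
    refine ⟨(c : G ⧸ Subgroup.centralizer {x}), ?_⟩
    obtain ⟨⟨u, hu⟩, hx⟩ := QuotientGroup.mk_out_eq_mul (Subgroup.centralizer {x}) c
    rw [hx]
    have h2 : u * x * u⁻¹ = x := by rw [Subgroup.mem_centralizer_singleton_iff.1 hu]; group
    calc _ = c * (u * x * u⁻¹) * c⁻¹ := by simp only; group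
      _ = _ := by rw [h2]
  · rintro ⟨q, rfl⟩
    exact ⟨_, rfl⟩

theorem ncard_conjugatesOf_le [Finite G] (x : G) :
    (conjugatesOf x).ncard ≤ (Subgroup.centralizer {x}).index := by
  rw [conjugatesOf_eq_range_out]
  exact Finite.card_range_le _

theorem ncard_iUnion_le_mul {ι α : Type*} [Finite ι] (s : ι → Set α) (c : ℕ)
    (hs : ∀ i, (s i).ncard ≤ c) : (⋃ i, s i).ncard ≤ Nat.card ι * c := by
  have := Fintype.ofFinite ι
  have h := Finset.set_ncard_biUnion_le Finset.univ s
  simp only [Finset.mem_univ, Set.iUnion_true] at h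
  refine h.trans ((Finset.sum_le_card_nsmul _ _ c fun i _ => hs i).trans ?_)
  simp [Nat.card_eq_fintype_card]

/-- B. H. Neumann: if all conjugacy classes have size at most `m`, the number of commutators is
bounded in terms of `m`. -/
theorem ncard_commutatorSet_le [Finite G] {m : ℕ}
    (hm : ∀ x : G, (Subgroup.centralizer {x}).index ≤ m) :
    (commutatorSet G).ncard ≤ m ^ m * (m * m * m) := by
  have hc : ∀ x : G, (conjugatesOf x).ncard ≤ m := fun x => (ncard_conjugatesOf_le x).trans (hm x)
  have hm0 : 0 < m := lt_of_lt_of_le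
    (Nat.pos_of_ne_zero (Subgroup.index_ne_zero_of_finite)) (hm 1)
  obtain ⟨a, ha⟩ := Finite.exists_max fun x : G => (conjugatesOf x).ncard
  set B : Set G := Set.range fun q : G ⧸ Subgroup.centralizer {a} => q.out
  have hB : B.ncard ≤ m := (Finite.card_range_le _).trans (hm a)
  set V := Subgroup.centralizer B
  have hV : V.index ≤ m ^ m :=
    (index_centralizer_le_pow_card hm B).trans (Nat.pow_le_pow_right hm0 hB)
  -- As u commutes with the representatives in B, the left side is contained in the right; the class
  -- of a has maximal size, so they are equal.
  have hconj : ∀ u ∈ V, (u • conjugatesOf a) = conjugatesOf (u * a) := by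
    intro u hu
    refine Set.eq_of_subset_of_ncard_le ?_ (by rw [Set.ncard_smul_set]; exact ha _)
      (Set.toFinite _)
    rw [conjugatesOf_eq_range_out]
    rintro _ ⟨_, ⟨q, rfl⟩, rfl⟩
    rw [mem_conjugatesOf_iff_exists]
    refine ⟨q.out, ?_⟩
    have h := Subgroup.mem_centralizer_iff.1 hu _ ⟨q, rfl⟩
    simp only [smul_eq_mul]
    rw [← mul_assoc, h]
    group
  have hcomm : ∀ u ∈ V, ∀ d : G, ⁅u, d⁆ ∈ conjugatesOf a / conjugatesOf a := by
    intro u hu d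
    have h : d * (u⁻¹ * a) * d⁻¹ ∈ u⁻¹ • conjugatesOf a := by
      rw [hconj _ (inv_mem hu), mem_conjugatesOf_iff_exists]
      exact ⟨d, rfl⟩
    obtain ⟨b, hb, hbd⟩ := h
    refine ⟨b, hb, d * a * d⁻¹, by rw [mem_conjugatesOf_iff_exists]; exact ⟨d, rfl⟩, ?_⟩
    have hb' : b = u * (d * (u⁻¹ * a) * d⁻¹) := by
      rw [← hbd]; simp
    simp only [hb', commutatorElement_def, div_eq_mul_inv]
    group
  set F : G ⧸ V → Set G := fun q =>
    MulAut.conj q.out • (conjugatesOf a / conjugatesOf a) * (q.out • conjugatesOf (q.out⁻¹))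
  have hF : ∀ q, (F q).ncard ≤ m * m * m := by
    intro q
    refine Set.natCard_mul_le.trans (Nat.mul_le_mul ?_ ?_)
    · refine le_trans (le_of_eq ?_) (Set.natCard_div_le.trans (Nat.mul_le_mul (hc a) (hc a)))
      exact Set.ncard_smul_set _ _
    · refine le_trans (le_of_eq ?_) (hc (q.out⁻¹))
      exact Set.ncard_smul_set _ _
  have hsub : commutatorSet G ⊆ ⋃ q, F q := by
    rintro _ ⟨g, d, rfl⟩
    rw [Set.mem_iUnion]
    refine ⟨(g : G ⧸ V), ?_⟩
    obtain ⟨⟨u, hu⟩, hg⟩ := QuotientGroup.mk_out_eq_mul V g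
    set t := (g : G ⧸ V).out
    have hgt : g = t * u⁻¹ := by rw [hg]; simp
    refine ⟨t * ⁅u⁻¹, d⁆ * t⁻¹, ⟨_, hcomm _ (inv_mem hu) d, rfl⟩, t * (d * t⁻¹ * d⁻¹),
      ⟨_, by rw [mem_conjugatesOf_iff_exists]; exact ⟨d, rfl⟩, rfl⟩, ?_⟩
    rw [hgt]
    simp only [commutatorElement_def]
    group
  calc _ ≤ (⋃ q, F q).ncard := Set.ncard_le_ncard hsub (Set.toFinite _)
    _ ≤ V.index * (m * m * m) := ncard_iUnion_le_mul F _ hF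
    _ ≤ _ := Nat.mul_le_mul_right _ hV

theorem exists_card_commutator_le (m : ℕ) : ∃ b : ℕ, ∀ (G : Type*) [Group G] [Finite G],
    (∀ x : G, (Subgroup.centralizer {x}).index ≤ m) → Nat.card (commutator G) ≤ b := by
  -- The supremum over all possible numbers of commutators avoids any appeal to monotonicity of the
  -- bound.
  refine ⟨(Finset.range (m ^ m * (m * m * m) + 1)).sup Subgroup.cardCommutatorBound,
    fun G _ _ hm => ?_⟩
  refine (Subgroup.card_commutator_le_of_finite_commutatorSet G).trans ?_
  refine Finset.le_sup (f := Subgroup.cardCommutatorBound) (Finset.mem_range.2 ?_)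
  exact Nat.lt_succ_of_le (ncard_commutatorSet_le hm)

end BoundedClasses

/-! ### Commutators with a subgroup centralizing the derived subgroup -/

section CentralBilinear

variable {G : Type*} [Group G]

/-- The elements `w` of `W` with `⁅N, w⁆ ⊆ M`, where `W` centralizes the commutator subgroup. -/
def commutatorInto (N W M : Subgroup G) (hW : W ≤ Subgroup.centralizer (commutator G : Set G)) :
    Subgroup G where
  carrier := {w | w ∈ W ∧ ∀ n ∈ N, ⁅n, w⁆ ∈ M}
  one_mem' := ⟨one_mem W, fun n _ => by simp⟩
  mul_mem' := by
    rintro v w ⟨hv, hv'⟩ ⟨hw, hw'⟩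
    refine ⟨mul_mem hv hw, fun n hn => ?_⟩
    have hc := Subgroup.mem_centralizer_iff.1 (hW hv) ⁅n, w⁆
      (Subgroup.commutator_mem_commutator (Subgroup.mem_top _) (Subgroup.mem_top _))
    have : ⁅n, v * w⁆ = ⁅n, v⁆ * ⁅n, w⁆ := by
      rw [commutatorElement_mul_right_eq_mul_conj, mul_assoc, mul_assoc,
        ← mul_assoc v, ← hc]
      group
    rw [this]
    exact mul_mem (hv' n hn) (hw' n hn)
  inv_mem' := by
    rintro w ⟨hw, hw'⟩
    refine ⟨inv_mem hw, fun n hn => ?_⟩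
    have hc := Subgroup.mem_centralizer_iff.1 (hW hw) ⁅w, n⁆
      (Subgroup.commutator_mem_commutator (Subgroup.mem_top _) (Subgroup.mem_top _))
    have : ⁅n, w⁻¹⁆ = ⁅n, w⁆⁻¹ := by
      rw [commutatorElement_inv_right, commutatorElement_inv, mul_assoc, hc]
      group
    rw [this]
    exact inv_mem (hw' n hn)

/-- Write y = tw with t ∈ T, w ∈ W. On N = W ⊓ C(T) the map n ↦ ⁅n, w⁆ is a homomorphism into L =
⁅W, W⁆, and ⁅n, y⁆ is its conjugate by t. If y is bad, the image is a proper subgroup M of L, so w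
lies in one of at most 2^|L| subgroups of index at least k. -/
theorem index_commutatorInto_bounds_ncard [Finite G] (W : Subgroup G) [W.Normal]
    (hW : W ≤ Subgroup.centralizer (commutator G : Set G)) (T : Set G)
    (hT : ∀ g, ∃ t ∈ T, t⁻¹ * g ∈ W) {k : ℕ}
    (hk : ∀ M < ⁅W, W⁆, k ≤ (commutatorInto (W ⊓ Subgroup.centralizer T) W M hW).index) :
    k * {y : G | ¬ ∀ l ∈ ⁅W, W⁆, ∃ x : G, ⁅x, y⁆ = l}.ncard ≤
      T.ncard * (2 ^ Nat.card (⁅W, W⁆ : Subgroup G) * Nat.card G) := by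
  set N := W ⊓ Subgroup.centralizer T
  set L := ⁅W, W⁆
  have hNK : ∀ n ∈ N, ∀ c ∈ commutator G, c * n = n * c := fun n hn =>
    Subgroup.mem_centralizer_iff.1 (hW hn.1)
  have hmem : ∀ a b : G, ⁅a, b⁆ ∈ commutator G := fun a b =>
    Subgroup.commutator_mem_commutator (Subgroup.mem_top _) (Subgroup.mem_top _)
  set B : Set G := ⋃ M : Set.Iio L, (commutatorInto N W M hW : Set G)
  have hbad : {y : G | ¬ ∀ l ∈ L, ∃ x : G, ⁅x, y⁆ = l} ⊆ T * B := by
    intro y hy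
    obtain ⟨t, ht, htw⟩ := hT y
    refine ⟨t, ht, t⁻¹ * y, ?_, by simp⟩
    set w := t⁻¹ * y
    have hyw : y = t * w := by simp [w]
    by_contra hwB
    refine hy fun l hl => ?_
    let φ : N →* G :=
      { toFun := fun n => ⁅(n : G), w⁆
        map_one' := by simp
        map_mul' := by
          intro a b
          have := hNK a a.2 ⁅(b : G), w⁆ (hmem _ _)
          have h2 := hNK b b.2 ⁅(a : G), w⁆ (hmem _ _)
          have h3 := Subgroup.mem_centralizer_iff.1 (hW htw) ⁅(b : G), w⁆ (hmem _ _)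
          have h4 : Commute ⁅(b : G), w⁆ a := this
          have h5 : Commute ⁅(b : G), w⁆ w := h3
          have h6 : Commute ⁅(b : G), w⁆ ⁅(a : G), w⁆ := by
            rw [commutatorElement_def a.1 w]
            exact ((h4.mul_right h5).mul_right h4.inv_right).mul_right h5.inv_right
          rw [Subgroup.coe_mul, commutatorElement_mul_left_eq_conj_mul, ← this, ← h6.eq]
          group }
    have hφ : φ.range ≤ L := by
      rintro _ ⟨n, rfl⟩
      exact Subgroup.commutator_mem_commutator n.2.1 htw
    have hφ' : φ.range = L := by
      by_contra hne
      refine hwB (Set.mem_iUnion.2 ⟨⟨φ.range, lt_of_le_of_ne hφ hne⟩, htw, fun n hn => ?_⟩)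
      exact ⟨⟨n, hn⟩, rfl⟩
    have hl' : t⁻¹ * l * t ∈ φ.range := by
      rw [hφ']
      simpa using (inferInstance : L.Normal).conj_mem l hl t⁻¹
    obtain ⟨⟨n, hn⟩, hnl⟩ := hl'
    have hnl : ⁅n, w⁆ = t⁻¹ * l * t := hnl
    have hnt : t * n = n * t := Subgroup.mem_centralizer_iff.1 hn.2 t ht
    refine ⟨n, ?_⟩
    have hnt' : ⁅n, t⁆ = 1 := commutatorElement_eq_one_iff_mul_comm.2 hnt.symm
    rw [hyw, commutatorElement_mul_right_eq_mul_conj, hnt', hnl]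
    group
  have hB : k * B.ncard ≤ 2 ^ Nat.card L * Nat.card G := by
    rcases Nat.eq_zero_or_pos k with rfl | hk0
    · simp
    have hM : Nat.card (Set.Iio L) ≤ 2 ^ Nat.card L := by
      have : Nat.card (Set L) = 2 ^ Nat.card L := by
        have := Fintype.ofFinite L
        simp [Nat.card_eq_fintype_card]
      rw [← this]
      refine Nat.card_le_card_of_injective (fun M : Set.Iio L => {l : L | (l : G) ∈ M.1}) ?_
      intro M M' h
      ext g
      constructor
      · intro hg
        have : (⟨g, (show M.1 < L from M.2).le hg⟩ : L) ∈ {l : L | (l : G) ∈ M.1} := hg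
        rw [show {l : L | (l : G) ∈ M.1} = {l : L | (l : G) ∈ M'.1} from h] at this
        exact this
      · intro hg
        have : (⟨g, (show M'.1 < L from M'.2).le hg⟩ : L) ∈ {l : L | (l : G) ∈ M'.1} := hg
        rw [← show {l : L | (l : G) ∈ M.1} = {l : L | (l : G) ∈ M'.1} from h] at this
        exact this
    have h1 := ncard_iUnion_le_mul
      (fun M : Set.Iio L => (commutatorInto N W M hW : Set G)) (Nat.card G / k) (fun M => by
        rw [Nat.le_div_iff_mul_le hk0]
        calc _ ≤ Nat.card (commutatorInto N W M hW) * (commutatorInto N W M hW).index :=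
              Nat.mul_le_mul le_rfl (hk M M.2)
          _ = _ := Subgroup.card_mul_index _)
    calc k * B.ncard ≤ k * (2 ^ Nat.card L * (Nat.card G / k)) :=
          Nat.mul_le_mul_left _ (h1.trans (Nat.mul_le_mul_right _ hM))
      _ = 2 ^ Nat.card L * (k * (Nat.card G / k)) := by ring
      _ ≤ _ := Nat.mul_le_mul_left _ (Nat.mul_div_le _ _)
  have h2 : {y : G | ¬ ∀ l ∈ L, ∃ x : G, ⁅x, y⁆ = l}.ncard ≤ T.ncard * B.ncard :=
    (Set.ncard_le_ncard hbad (Set.toFinite _)).trans Set.natCard_mul_le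
  calc _ ≤ k * (T.ncard * B.ncard) := Nat.mul_le_mul_left _ h2
    _ = T.ncard * (k * B.ncard) := by ring
    _ ≤ _ := Nat.mul_le_mul_left _ hB

/-- W ⊓ C(T) commutes with T, and with W modulo ⁅W, W⁆; since G = TW, its image in the quotient is
central. -/
theorem index_center_quotient_commutator_le [Finite G] (W : Subgroup G) [W.Normal] (T : Set G)
    (hT : ∀ g, ∃ t ∈ T, t⁻¹ * g ∈ W) :
    (Subgroup.center (G ⧸ ⁅W, W⁆)).index ≤ (W ⊓ Subgroup.centralizer T).index := by
  rw [← Subgroup.index_comap_of_surjective _ (QuotientGroup.mk'_surjective ⁅W, W⁆)]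
  refine Subgroup.index_antitone fun n hn => ?_
  rw [Subgroup.mem_comap, Subgroup.mem_center_iff]
  intro q
  obtain ⟨g, rfl⟩ := QuotientGroup.mk'_surjective _ q
  obtain ⟨t, ht, htw⟩ := hT g
  have hnt : t * n = n * t := Subgroup.mem_centralizer_iff.1 hn.2 t ht
  have h : ⁅g, n⁆ ∈ ⁅W, W⁆ := by
    have hg : g = t * (t⁻¹ * g) := by simp
    have h0 : t * ⁅t⁻¹ * g, n⁆ * t⁻¹ ∈ ⁅W, W⁆ :=
      (inferInstance : ⁅W, W⁆.Normal).conj_mem _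
        (Subgroup.commutator_mem_commutator htw hn.1) t
    rw [hg, commutatorElement_mul_left_eq_conj_mul,
      commutatorElement_eq_one_iff_mul_comm.2 hnt, mul_one]
    exact h0
  have h' : ⁅QuotientGroup.mk' ⁅W, W⁆ g, QuotientGroup.mk' ⁅W, W⁆ n⁆ = 1 := by
    rw [← map_commutatorElement]
    exact (QuotientGroup.eq_one_iff _).2 h
  exact commutatorElement_eq_one_iff_mul_comm.1 h'

theorem index_normalCore_le_factorial [Finite G] (H : Subgroup G) :
    H.normalCore.index ≤ H.index.factorial := by
  rw [Subgroup.normalCore_eq_ker, Subgroup.index_ker, Subgroup.index_eq_card, ← Nat.card_perm]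
  exact Subgroup.card_le_card_group _

end CentralBilinear

/-! ### Extremal choices along an ultrafilter -/

section UltrafilterSelection

open Filter

variable {ι : Type*} (U : Ultrafilter ι)

theorem Ultrafilter.eventually_eq_of_finite {α : Type*} {s : Set α} (hs : s.Finite) {f : ι → α}
    (hf : ∀ᶠ i in U, f i ∈ s) : ∃ c ∈ s, ∀ᶠ i in U, f i = c := by
  have : (⋃ c ∈ s, {i | f i = c}) ∈ U := by
    filter_upwards [hf] with i hi
    simpa using hi
  exact (Ultrafilter.finite_biUnion_mem_iff hs).1 this

theorem Ultrafilter.exists_eventually_minimal {A : ι → Type*} (S : Set (∀ i, A i))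
    (hS : S.Nonempty) (f : ∀ i, A i → ℕ) (hf : ∀ s ∈ S, ∃ b, ∀ᶠ i in U, f i (s i) ≤ b) :
    ∃ s ∈ S, ∃ c, (∀ᶠ i in U, f i (s i) = c) ∧ ∀ s' ∈ S, ∀ᶠ i in U, c ≤ f i (s' i) := by
  classical
  have hconst : ∀ s ∈ S, ∃ c, ∀ᶠ i in U, f i (s i) = c := by
    intro s hs
    obtain ⟨b, hb⟩ := hf s hs
    obtain ⟨c, -, hc⟩ := U.eventually_eq_of_finite (Set.finite_Iic b) hb
    exact ⟨c, hc⟩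
  have hex : ∃ c, ∃ s ∈ S, ∀ᶠ i in U, f i (s i) = c := by
    obtain ⟨s, hs⟩ := hS
    obtain ⟨c, hc⟩ := hconst s hs
    exact ⟨c, s, hs, hc⟩
  obtain ⟨s, hs, hc⟩ := Nat.find_spec hex
  refine ⟨s, hs, _, hc, fun s' hs' => ?_⟩
  obtain ⟨c', hc'⟩ := hconst s' hs'
  filter_upwards [hc'] with i hi
  rw [hi]
  exact Nat.find_min' hex ⟨s', hs', hc'⟩

end UltrafilterSelection

/-! ### The subgroup generated by small classes -/

section SmallClasses

variable {G : Type*} [Group G]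

variable (G) in
/-- The subgroup generated by the elements with at most `n` conjugates. -/
def smallClassSubgroup (n : ℕ) : Subgroup G :=
  Subgroup.closure {x : G | (Subgroup.centralizer {x}).index ≤ n}

theorem smallClassSubgroup_mono : Monotone (smallClassSubgroup G) := fun _ _ h =>
  Subgroup.closure_mono fun _ hx => le_trans hx h

theorem lt_index_centralizer_of_notMem {n : ℕ} {x : G} (hx : x ∉ smallClassSubgroup G n) :
    n < (Subgroup.centralizer {x}).index := by
  by_contra h
  exact hx (Subgroup.subset_closure (not_lt.1 h))

variable [Finite G]

/-- The average of |C(x)|/|G| is at least 1/k, and elements with more than n ≥ 2k conjugates account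
for at most half of that. -/
theorem card_le_mul_ncard_of_le_commProb {k n : ℕ} (hk : 0 < k)
    (hG : (1 : ℚ) / k ≤ commProb G) (hn : 2 * k ≤ n) :
    Nat.card G ≤ 2 * k * {x : G | (Subgroup.centralizer {x}).index ≤ n}.ncard := by
  classical
  have := Fintype.ofFinite G
  set X : Set G := {x : G | (Subgroup.centralizer {x}).index ≤ n}
  have hc : (0 : ℚ) < Nat.card G := by exact_mod_cast Nat.card_pos
  have hk' : (0 : ℚ) < k := by exact_mod_cast hk
  have h1 : ∀ x : G, (Nat.card (Subgroup.centralizer {x}) : ℚ) ≤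
      (if x ∈ X then (Nat.card G : ℚ) else 0) + Nat.card G / (2 * k) := by
    intro x
    by_cases hx : x ∈ X
    · rw [if_pos hx]
      have : (Nat.card (Subgroup.centralizer {x}) : ℚ) ≤ Nat.card G := by
        exact_mod_cast Subgroup.card_le_card_group _
      have : (0 : ℚ) ≤ Nat.card G / (2 * k) := by positivity
      linarith
    · rw [if_neg hx, zero_add, card_centralizer_eq_div]
      have : (2 * k : ℚ) ≤ (Subgroup.centralizer {x}).index := by
        have : n < (Subgroup.centralizer {x}).index := not_le.1 hx
        exact_mod_cast hn.trans this.le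
      gcongr
  have h2 := Finset.sum_le_sum fun x (_ : x ∈ Finset.univ) => h1 x
  rw [sum_card_centralizer, Finset.sum_add_distrib, ← Finset.sum_filter, Finset.sum_const,
    Finset.sum_const, Finset.card_univ, ← Nat.card_eq_fintype_card, nsmul_eq_mul,
    nsmul_eq_mul] at h2
  have hX : (Finset.univ.filter (· ∈ X)).card = X.ncard := by
    rw [← Nat.card_coe_set_eq, Nat.card_eq_fintype_card, Fintype.card_subtype]
  rw [hX] at h2
  have h3 : (1 : ℚ) / k * (Nat.card G : ℚ) ^ 2 ≤
      X.ncard * Nat.card G + Nat.card G * (Nat.card G / (2 * k)) :=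
    (mul_le_mul_of_nonneg_right hG (by positivity)).trans h2
  have h4 : (Nat.card G : ℚ) * Nat.card G ≤ (2 * k * X.ncard) * Nat.card G := by
    have h5 := mul_le_mul_of_nonneg_left h3 (show (0 : ℚ) ≤ 2 * k by positivity)
    have e1 : 2 * (k : ℚ) * (1 / k * (Nat.card G : ℚ) ^ 2) = 2 * (Nat.card G : ℚ) ^ 2 := by
      field_simp
    have e2 : 2 * (k : ℚ) * (X.ncard * Nat.card G + Nat.card G * (Nat.card G / (2 * k))) =
      2 * k * X.ncard * Nat.card G + (Nat.card G : ℚ) ^ 2 := by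
      field_simp
    rw [e1, e2] at h5
    linarith
  exact_mod_cast le_of_mul_le_mul_right h4 hc

theorem index_smallClassSubgroup_le {k n : ℕ} (hk : 0 < k)
    (hG : (1 : ℚ) / k ≤ commProb G) (hn : 2 * k ≤ n) :
    (smallClassSubgroup G n).index ≤ 2 * k := by
  have h1 := card_le_mul_ncard_of_le_commProb hk hG hn
  have h2 : {x : G | (Subgroup.centralizer {x}).index ≤ n}.ncard ≤
      Nat.card (smallClassSubgroup G n) :=
    Set.ncard_le_ncard Subgroup.subset_closure (Set.toFinite _)
  have h3 := (smallClassSubgroup G n).index_mul_card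
  have h4 : (smallClassSubgroup G n).index * Nat.card (smallClassSubgroup G n) ≤
      2 * k * Nat.card (smallClassSubgroup G n) := by
    rw [h3]
    exact h1.trans (Nat.mul_le_mul_left _ h2)
  exact Nat.le_of_mul_le_mul_right h4 Nat.card_pos

theorem index_centralizer_le_of_mem_smallClassSubgroup {k n : ℕ} (hk : 0 < k)
    (hG : (1 : ℚ) / k ≤ commProb G) (hn : 2 * k ≤ n) {x : G} (hx : x ∈ smallClassSubgroup G n) :
    (Subgroup.centralizer {x}).index ≤ n ^ (3 * (2 * k + 1) + 1) := by
  set X : Set G := {x : G | (Subgroup.centralizer {x}).index ≤ n}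
  have h1 := card_le_mul_ncard_of_le_commProb hk hG hn
  have hone : (1 : G) ∈ X := by
    have : Subgroup.centralizer {(1 : G)} = ⊤ := by
      ext; simp [Subgroup.mem_centralizer_singleton_iff]
    simp only [X, Set.mem_ofPred_eq, this, Subgroup.index_top]
    omega
  have hinv : X⁻¹ = X := by
    ext x
    simp only [X, Set.mem_inv, Set.mem_ofPred_eq, index_centralizer_inv]
  have hpos : 0 < X.ncard := (Set.ncard_pos (Set.toFinite _)).2 ⟨1, hone⟩
  have hlt : Nat.card G < (2 * k + 1) * X.ncard := by
    have : (2 * k + 1) * X.ncard = 2 * k * X.ncard + X.ncard := by ring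
    rw [this]
    exact h1.trans_lt (Nat.lt_add_of_pos_right hpos)
  exact index_centralizer_le_pow_of_mem_pow (fun _ h => h) _ _
    (closure_subset_pow_of_card_lt hone hinv hlt hx)

theorem index_centralizer_coe_le (D : Subgroup G) (x : D) :
    (Subgroup.centralizer {x}).index ≤ (Subgroup.centralizer {(x : G)}).index := by
  have h : Subgroup.centralizer {x} = (Subgroup.centralizer {(x : G)}).subgroupOf D := by
    ext g
    simp [Subgroup.mem_subgroupOf, Subgroup.mem_centralizer_singleton_iff, Subtype.ext_iff]
  rw [h, ← Subgroup.relIndex_top_right (H := Subgroup.centralizer {(x : G)})]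
  exact Subgroup.relIndex_le_of_le_right le_top
    (by rw [Subgroup.relIndex_top_right]; exact Subgroup.index_ne_zero_of_finite)

end SmallClasses

/-! ### Approximation along an ultrafilter -/

section Families

open Filter

universe u

variable {ι : Type*} (U : Ultrafilter ι)

theorem exists_eventually_large_classes_outside (G : ι → Type u) [∀ i, Group (G i)]
    [∀ i, Finite (G i)] {k : ℕ} (hk : 0 < k) (hG : ∀ i, (1 : ℚ) / k ≤ commProb (G i)) :
    ∃ (D : ∀ i, Subgroup (G i)) (b m : ℕ), (∀ i, (D i).index ≤ b) ∧
      (∀ i, ∀ x : D i, (Subgroup.centralizer {x}).index ≤ m) ∧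
      ∀ r : ℕ, ∀ᶠ i in U, ∀ x ∉ D i, r ≤ (Subgroup.centralizer {x}).index := by
  obtain ⟨_, ⟨n, hn, rfl⟩, c, hc, hmin⟩ := U.exists_eventually_minimal
    {D : ∀ i, Subgroup (G i) | ∃ n, 2 * k ≤ n ∧ D = fun i => smallClassSubgroup (G i) n}
    ⟨_, 2 * k, le_rfl, rfl⟩ (fun i D => D.index) (by
      rintro _ ⟨n, hn, rfl⟩
      exact ⟨2 * k, Eventually.of_forall fun i => index_smallClassSubgroup_le hk (hG i) hn⟩)
  refine ⟨fun i => smallClassSubgroup (G i) n, 2 * k, n ^ (3 * (2 * k + 1) + 1),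
    fun i => index_smallClassSubgroup_le hk (hG i) hn, fun i x =>
    (index_centralizer_coe_le _ x).trans
      (index_centralizer_le_of_mem_smallClassSubgroup hk (hG i) hn x.2), fun r => ?_⟩
  filter_upwards [hc, hmin _ ⟨max n r, hn.trans (le_max_left _ _), rfl⟩] with i h1 h2 x hx
  -- Raising the threshold can only enlarge the subgroup, and minimality of the index forbids a
  -- strict enlargement.
  have heq : smallClassSubgroup (G i) n = smallClassSubgroup (G i) (max n r) := by
    refine eq_of_le_of_not_lt (smallClassSubgroup_mono (le_max_left _ _)) fun hlt => ?_
    have := Subgroup.index_strictAnti hlt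
    omega
  rw [heq] at hx
  exact (le_max_right n r).trans (lt_index_centralizer_of_notMem hx).le

theorem exists_eventually_equidistributed_commutators (D : ι → Type u) [∀ i, Group (D i)]
    [∀ i, Finite (D i)] {m : ℕ} (hm : ∀ i, ∀ x : D i, (Subgroup.centralizer {x}).index ≤ m) :
    ∃ (L : ∀ i, Subgroup (D i)) (_ : ∀ i, (L i).Normal) (b : ℕ),
      (∀ i, Nat.card (L i) ≤ b) ∧
      (∀ᶠ i in U, (Subgroup.center (D i ⧸ L i)).index ≤ b) ∧
      ∀ δ : ℚ, 0 < δ → ∀ᶠ i in U,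
        commProb (D i) ≤ commProb (D i ⧸ L i) / Nat.card (L i) + δ := by
  classical
  obtain ⟨b₀, hb₀⟩ := exists_card_commutator_le.{u} m
  have hm0 : ∀ i, 0 < m := fun i => lt_of_lt_of_le
    (Nat.pos_of_ne_zero (Subgroup.index_ne_zero_of_finite)) (hm i 1)
  have hcard : ∀ i (W : Subgroup (D i)), Nat.card (⁅W, W⁆ : Subgroup (D i)) ≤ b₀ := fun i W =>
    (Subgroup.card_le_of_le (Subgroup.commutator_mono le_top le_top)).trans (hb₀ (D i) (hm i))
  let C : ∀ i, Subgroup (D i) := fun i => Subgroup.centralizer (commutator (D i) : Set (D i))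
  have hC : ∀ i, (C i).index ≤ m ^ b₀ := fun i =>
    (index_centralizer_le_pow_card (hm i) _).trans
      (Nat.pow_le_pow_right (hm0 i) (hb₀ (D i) (hm i)))
  obtain ⟨W, ⟨hWn, hWC, bW, hWb⟩, c, hc, hmin⟩ := U.exists_eventually_minimal
    {W : ∀ i, Subgroup (D i) | (∀ i, (W i).Normal) ∧ (∀ i, W i ≤ C i) ∧
      ∃ b, ∀ᶠ i in U, (W i).index ≤ b}
    ⟨C, fun i => inferInstance, fun i => le_rfl, m ^ b₀, Eventually.of_forall hC⟩
    (fun i W => Nat.card (⁅W, W⁆ : Subgroup (D i)))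
    (fun W _ => ⟨b₀, Eventually.of_forall fun i => hcard i (W i)⟩)
  let T : ∀ i, Set (D i) := fun i => Set.range fun q : D i ⧸ W i => q.out
  have hT : ∀ i, ∀ g : D i, ∃ t ∈ T i, t⁻¹ * g ∈ W i := by
    intro i g
    refine ⟨(g : D i ⧸ W i).out, ⟨_, rfl⟩, ?_⟩
    rw [← QuotientGroup.eq, QuotientGroup.out_eq']
  have hTb : ∀ᶠ i in U, (T i).ncard ≤ bW := by
    filter_upwards [hWb] with i hi
    exact (Finite.card_range_le _).trans hi
  let N : ∀ i, Subgroup (D i) := fun i => W i ⊓ Subgroup.centralizer (T i)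
  have hNb : ∀ᶠ i in U, (N i).index ≤ bW * m ^ bW := by
    filter_upwards [hWb, hTb] with i h1 h2
    refine Subgroup.index_inf_le.trans (Nat.mul_le_mul h1 ?_)
    exact (index_centralizer_le_pow_card (hm i) _).trans (Nat.pow_le_pow_right (hm0 i) h2)
  -- Otherwise some Y = `commutatorInto N W M` has bounded index for some M < ⁅W, W⁆. The normal
  -- core V of N ⊓ Y also has bounded index, and ⁅V, V⁆ ≤ M contradicts minimality.
  have hlarge : ∀ r : ℕ, ∀ᶠ i in U, ∀ M < ⁅W i, W i⁆,
      r ≤ (commutatorInto (N i) (W i) M (hWC i)).index := by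
    intro r
    by_contra hnot
    rw [← Ultrafilter.eventually_not] at hnot
    have hV : ∀ i, ∃ V : Subgroup (D i), V.Normal ∧ V ≤ C i ∧
        ((¬ ∀ M < ⁅W i, W i⁆, r ≤ (commutatorInto (N i) (W i) M (hWC i)).index) →
          V.index ≤ ((N i).index * r).factorial ∧
          Nat.card (⁅V, V⁆ : Subgroup (D i)) < Nat.card (⁅W i, W i⁆ : Subgroup (D i))) := by
      intro i
      by_cases h : ∀ M < ⁅W i, W i⁆, r ≤ (commutatorInto (N i) (W i) M (hWC i)).index
      -- Filler at the indices where there is nothing to contradict.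
      · exact ⟨W i, hWn i, hWC i, fun h' => absurd h h'⟩
      · have h' := h
        push Not at h'
        obtain ⟨M, hM, hr⟩ := h'
        set Y := commutatorInto (N i) (W i) M (hWC i)
        refine ⟨(N i ⊓ Y).normalCore, inferInstance,
          (Subgroup.normalCore_le _).trans (inf_le_left.trans (inf_le_left.trans (hWC i))),
          fun _ => ⟨?_, ?_⟩⟩
        · refine (index_normalCore_le_factorial _).trans (Nat.factorial_le ?_)
          exact Subgroup.index_inf_le.trans (Nat.mul_le_mul_left _ hr.le)
        · have hle : ⁅(N i ⊓ Y).normalCore, (N i ⊓ Y).normalCore⁆ ≤ M := by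
            rw [Subgroup.commutator_le]
            intro a ha b hb
            exact (Subgroup.normalCore_le _ hb).2.2 a (Subgroup.normalCore_le _ ha).1
          have h1 := hle.trans_lt hM
          have h2 := Set.ncard_lt_ncard (SetLike.coe_ssubset_coe.2 h1) (Set.toFinite _)
          exact h2
    choose V hVn hVC hV using hV
    have h1 := hmin V ⟨hVn, hVC, (bW * m ^ bW * r).factorial, by
      filter_upwards [hnot, hNb] with i h2 h3
      exact (hV i h2).1.trans (Nat.factorial_le (Nat.mul_le_mul_right _ h3))⟩
    obtain ⟨i, h2, h3, h4⟩ := (hnot.and (h1.and hc)).exists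
    have := (hV i h2).2
    omega
  refine ⟨fun i => ⁅W i, W i⁆, fun i => inferInstance, max b₀ (bW * m ^ bW),
    fun i => (hcard i _).trans (le_max_left _ _), ?_, fun δ hδ => ?_⟩
  · filter_upwards [hNb] with i hi
    exact (index_center_quotient_commutator_le (W i) (T i) (hT i)).trans
      (hi.trans (le_max_right _ _))
  · obtain ⟨r, hr⟩ := exists_nat_gt ((bW * 2 ^ b₀ : ℕ) / δ)
    have hr0 : (0 : ℚ) < r := lt_of_le_of_lt (by positivity) hr
    filter_upwards [hTb, hlarge r] with i h1 h2
    refine (commProb_le_commProb_quotient_add ⁅W i, W i⁆).trans (add_le_add le_rfl ?_)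
    have h3 := index_commutatorInto_bounds_ncard (W i) (hWC i) (T i) (hT i) h2
    have h4 : r * {y : D i | ¬ ∀ l ∈ ⁅W i, W i⁆, ∃ x : D i, ⁅x, y⁆ = l}.ncard ≤
        bW * 2 ^ b₀ * Nat.card (D i) := by
      refine h3.trans ?_
      rw [← mul_assoc]
      exact Nat.mul_le_mul_right _ (Nat.mul_le_mul h1
        (Nat.pow_le_pow_right (by norm_num) (hcard i _)))
    rw [Nat.card_coe_set_eq, div_le_iff₀ (by exact_mod_cast Nat.card_pos)]
    have h5 : (r : ℚ) * {y : D i | ¬ ∀ l ∈ ⁅W i, W i⁆, ∃ x : D i, ⁅x, y⁆ = l}.ncard ≤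
        (bW * 2 ^ b₀ : ℕ) * Nat.card (D i) := by exact_mod_cast h4
    have h6 : ((bW * 2 ^ b₀ : ℕ) : ℚ) * Nat.card (D i) ≤ r * δ * Nat.card (D i) := by
      gcongr
      exact ((div_lt_iff₀ hδ).1 hr).le
    refine le_of_mul_le_mul_left ?_ hr0
    calc _ ≤ _ := h5
      _ ≤ _ := h6
      _ = _ := by ring

theorem commProb_congr {M N : Type*} [Mul M] [Mul N] (e : M ≃* N) : commProb M = commProb N := by
  rw [commProb_def, commProb_def, Nat.card_congr e.toEquiv]
  congr 2
  refine Nat.card_congr ((e.toEquiv.prodCongr e.toEquiv).subtypeEquiv ?_)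
  rintro ⟨x, y⟩
  simp only [commute_iff_eq]
  exact ⟨fun h => by simpa using congrArg e h, fun h => e.injective (by simpa using h)⟩

/-- Multiply Q by a product of dihedral groups with commuting probability 1/n. That product is
finite because an infinite group would give 0. -/
theorem exists_group_commProb_eq_div (Q : Type u) [Group Q] [Finite Q] {n : ℕ} (hn : 0 < n) :
    ∃ (H : Type) (_ : Group H) (_ : Finite H), commProb H = commProb Q / n := by
  have h := DihedralGroup.commProb_reciprocal n
  have : Finite (DihedralGroup.Product (DihedralGroup.reciprocalFactors n)) := by
    by_contra hinf
    rw [not_finite_iff_infinite] at hinf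
    rw [commProb_eq_zero_of_infinite] at h
    have : (n : ℚ) ≠ 0 := by exact_mod_cast hn.ne'
    exact one_div_ne_zero this h.symm
  refine ⟨Shrink.{0} Q × DihedralGroup.Product (DihedralGroup.reciprocalFactors n),
    inferInstance, inferInstance, ?_⟩
  rw [commProb_prod, h, commProb_congr (Shrink.mulEquiv.{0} (α := Q))]
  ring

theorem exists_group_commProb_eventually_near (G : ι → Type u) [∀ i, Group (G i)]
    [∀ i, Finite (G i)] {k : ℕ} (hk : 0 < k) (hG : ∀ i, (1 : ℚ) / k ≤ commProb (G i)) :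
    ∃ (H : Type) (_ : Group H) (_ : Finite H), (∀ᶠ i in U, commProb H ≤ commProb (G i)) ∧
      ∀ δ : ℚ, 0 < δ → ∀ᶠ i in U, commProb (G i) ≤ commProb H + δ := by
  obtain ⟨D, b, m, hDb, hDm, hD⟩ := exists_eventually_large_classes_outside U G hk hG
  obtain ⟨L, hLn, b', hLb, hLc, hL⟩ :=
    exists_eventually_equidistributed_commutators U (fun i => D i) hDm
  let d : ι → ℕ := fun i => Nat.card (L i) * (D i).index ^ 2
  have hd : ∀ i, 0 < d i := fun i => Nat.mul_pos Nat.card_pos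
    (Nat.pow_pos (Nat.pos_of_ne_zero Subgroup.index_ne_zero_of_finite))
  let v : ι → ℚ := fun i => commProb (D i ⧸ L i) / d i
  have hvle : ∀ i, v i ≤ commProb (G i) := by
    intro i
    have h1 := (D i).commProb_subgroup_le
    have h2 := (L i).commProb_quotient_le
    rw [div_le_iff₀ (by exact_mod_cast hd i)]
    push_cast [d]
    calc _ ≤ _ := h2
      _ ≤ _ := mul_le_mul_of_nonneg_right h1 (by positivity)
      _ = _ := by ring
  -- Eventually v i is a fraction with bounded numerator and denominator, so it is constant along U.
  have hvfin : ∀ᶠ i in U, v i ∈ (fun p : ℕ × ℕ => (p.1 : ℚ) / p.2) ''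
      (Set.Iic (b' ^ 2) ×ˢ Set.Iic (b' * b ^ 2 * b' ^ 2)) := by
    filter_upwards [hLc] with i hi
    obtain ⟨n, hn, hnv⟩ := commProb_mul_index_center_sq (G := D i ⧸ L i)
    set z := (Subgroup.center (D i ⧸ L i)).index
    have hz : (z : ℚ) ≠ 0 := by
      exact_mod_cast Subgroup.index_ne_zero_of_finite
    refine ⟨(n, d i * z ^ 2), ⟨hn.trans (Nat.pow_le_pow_left hi 2), ?_⟩, ?_⟩
    · exact Nat.mul_le_mul (Nat.mul_le_mul (hLb i) (Nat.pow_le_pow_left (hDb i) 2))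
        (Nat.pow_le_pow_left hi 2)
    · have hd' : (d i : ℚ) ≠ 0 := by exact_mod_cast (hd i).ne'
      simp only [v, ← hnv]
      push_cast
      field_simp
  obtain ⟨c, -, hc⟩ := U.eventually_eq_of_finite
    (((Set.finite_Iic _).prod (Set.finite_Iic _)).image _) hvfin
  obtain ⟨j, hj⟩ := hc.exists
  obtain ⟨H, hHg, hHf, hH⟩ := exists_group_commProb_eq_div (D j ⧸ L j) (hd j)
  have hHc : commProb H = c := hH.trans hj
  refine ⟨H, hHg, hHf, ?_, fun δ hδ => ?_⟩
  · filter_upwards [hc] with i hi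
    rw [hHc, ← hi]
    exact hvle i
  · obtain ⟨r, hr⟩ := exists_nat_gt (4 / δ)
    have hr0 : (0 : ℚ) < r := lt_of_le_of_lt (by positivity) hr
    filter_upwards [hc, hD r, hL (δ / 2) (by positivity)] with i h1 h2 h3
    have h4 := commProb_le_of_le_index_centralizer (D i) (by exact_mod_cast hr0) h2
    have h5 : (2 : ℚ) / r ≤ δ / 2 := by
      rw [div_le_iff₀ hr0]
      have := (div_lt_iff₀ hδ).1 hr
      linarith
    have hi1 : (1 : ℚ) ≤ (D i).index := by
      exact_mod_cast Nat.one_le_iff_ne_zero.2 Subgroup.index_ne_zero_of_finite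
    have hi2 : (1 : ℚ) ≤ ((D i).index : ℚ) ^ 2 := one_le_pow₀ hi1
    have h6 : commProb (D i) / ((D i).index : ℚ) ^ 2 ≤ v i + δ / 2 := by
      rw [div_le_iff₀ (by positivity)]
      have hL0 : (Nat.card (L i) : ℚ) ≠ 0 := by
        exact_mod_cast Nat.card_pos.ne'
      have e : v i * ((D i).index : ℚ) ^ 2 = commProb (D i ⧸ L i) / Nat.card (L i) := by
        simp only [v, d]
        push_cast
        field_simp
      rw [add_mul, e]
      have : δ / 2 ≤ δ / 2 * ((D i).index : ℚ) ^ 2 := le_mul_of_one_le_right (by positivity) hi2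
      linarith
    rw [hHc, ← h1]
    linarith

end Families

/-! ### Limit points of the set of commuting probabilities -/

section Limits

open Filter Topology

universe u

theorem exists_subsequence_tendsto_commProb (G : ℕ → Type u) [∀ i, Group (G i)]
    [∀ i, Finite (G i)] (hG : ∃ ε : ℝ, 0 < ε ∧ ∀ i, ε ≤ (commProb (G i) : ℝ)) :
    ∃ (H : Type) (_ : Group H) (_ : Finite H) (n : ℕ → ℕ), StrictMono n ∧
      Tendsto (fun i => (commProb (G (n i)) : ℝ)) atTop (𝓝 (commProb H : ℝ)) ∧
      ∀ i, commProb H ≤ commProb (G (n i)) := by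
  obtain ⟨ε, hε, hG⟩ := hG
  obtain ⟨k, hk⟩ := exists_nat_one_div_lt hε
  have hG' : ∀ i, (1 : ℚ) / (k + 1 : ℕ) ≤ commProb (G i) := by
    intro i
    have h : (((1 : ℚ) / (k + 1 : ℕ) : ℚ) : ℝ) ≤ (commProb (G i) : ℝ) := by
      push_cast
      exact hk.le.trans (hG i)
    exact_mod_cast h
  obtain ⟨H, hHg, hHf, hle, hnear⟩ :=
    exists_group_commProb_eventually_near (hyperfilter ℕ) G k.succ_pos hG'
  obtain ⟨n, hn, hP⟩ := extraction_forall_of_frequently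
    (P := fun r i => commProb H ≤ commProb (G i) ∧ commProb (G i) ≤ commProb H + 1 / (r + 1))
    fun r => ((hle.and (hnear _ (by positivity))).frequently).filter_mono
      Nat.hyperfilter_le_atTop
  refine ⟨H, hHg, hHf, n, hn, ?_, fun i => (hP i).1⟩
  have hlim : Tendsto (fun i : ℕ => (commProb H : ℝ) + 1 / ((i : ℝ) + 1)) atTop
      (𝓝 (commProb H : ℝ)) := by
    simpa using tendsto_one_div_add_atTop_nhds_zero_nat.const_add (commProb H : ℝ)
  refine tendsto_of_tendsto_of_tendsto_of_le_of_le tendsto_const_nhds hlim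
    (fun i => ?_) fun i => ?_
  · exact Rat.cast_le.2 (hP i).1
  · have h : (commProb (G (n i)) : ℝ) ≤ ((commProb H + 1 / (i + 1) : ℚ) : ℝ) := by
      exact_mod_cast (hP i).2
    refine h.trans (le_of_eq ?_)
    push_cast
    ring

theorem exists_commProb_eq_limit_of_mem {x : ℕ → ℝ} {l : ℝ}
    (hx : ∀ i, x i ∈ commutingProbabilities) (hl : 0 < l) (hlim : Tendsto x atTop (𝓝 l)) :
    ∃ (H : Type) (_ : Group H) (_ : Finite H), l = (commProb H : ℝ) ∧ ∃ᶠ i in atTop, l ≤ x i := by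
  obtain ⟨i₀, hi₀⟩ := eventually_atTop.1 (hlim.eventually_const_le (half_lt_self hl))
  choose G hGg hGf hGx using hx
  -- Dropping the first i₀ terms keeps the sequence above l / 2.
  obtain ⟨H, hHg, hHf, n, hn, hH, hle⟩ :=
    exists_subsequence_tendsto_commProb (fun i => G (i₀ + i))
      ⟨l / 2, by positivity, fun i => by rw [← hGx]; exact hi₀ _ (Nat.le_add_right _ _)⟩
  have hn' : StrictMono fun i => i₀ + n i := fun a b hab => Nat.add_lt_add_left (hn hab) _
  have heq : l = (commProb H : ℝ) := by
    refine tendsto_nhds_unique (hlim.comp hn'.tendsto_atTop) ?_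
    convert hH using 2 with i
    exact hGx _
  refine ⟨H, hHg, hHf, heq, hn'.tendsto_atTop.frequently (Frequently.of_forall fun i => ?_)⟩
  rw [heq, hGx]
  exact Rat.cast_le.2 (hle i)

theorem commutingProbabilities_nonneg {x : ℝ} (hx : x ∈ commutingProbabilities) : 0 ≤ x := by
  obtain ⟨G, _, _, rfl⟩ := hx
  exact_mod_cast (commProb_pos G).le

theorem isClosed_commutingProbabilities_union_zero : IsClosed (commutingProbabilities ∪ {0}) := by
  refine IsSeqClosed.isClosed fun x l hx hlim => ?_
  have hnonneg : ∀ i, 0 ≤ x i := by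
    intro i
    rcases hx i with h | h
    · exact commutingProbabilities_nonneg h
    · exact (Set.mem_singleton_iff.1 h).ge
  rcases (ge_of_tendsto' hlim hnonneg).eq_or_lt with rfl | hl
  · exact Or.inr rfl
  · left
    obtain ⟨i₀, hi₀⟩ := eventually_atTop.1 (hlim.eventually_const_lt hl)
    have hx' : ∀ i, x (i + i₀) ∈ commutingProbabilities := fun i =>
      (hx (i + i₀)).resolve_right (hi₀ _ (Nat.le_add_left _ _)).ne'
    obtain ⟨H, hHg, hHf, heq, -⟩ :=
      exists_commProb_eq_limit_of_mem hx' hl ((tendsto_add_atTop_iff_nat i₀).2 hlim)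
    exact ⟨H, hHg, hHf, heq⟩

theorem eventually_ge_limit_of_mem_commutingProbabilities {x : ℕ → ℝ} {l : ℝ}
    (hx : ∀ i, x i ∈ commutingProbabilities) (hl : 0 < l) (hlim : Tendsto x atTop (𝓝 l)) :
    ∀ᶠ i in atTop, l ≤ x i := by
  by_contra hnot
  -- A subsequence lying strictly below l has the same limit, so it must return to values ≥ l.
  obtain ⟨n, hn, hlt⟩ := extraction_of_frequently_atTop (not_eventually.1 hnot)
  obtain ⟨H, _, _, -, hfreq⟩ := exists_commProb_eq_limit_of_mem (fun i => hx (n i)) hl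
    (hlim.comp hn.tendsto_atTop)
  obtain ⟨i, hi⟩ := hfreq.exists
  exact hlt i hi

end Limits

theorem mainTheorem1 :
    -- the main theorem on sequences of finite groups
    (∀ (G : ℕ → Type*) [∀ i, Group (G i)] [∀ i, Finite (G i)],
      (∃ ε : ℝ, 0 < ε ∧ ∀ i, ε ≤ (commProb (G i) : ℝ)) →
      ∃ (H : Type) (_ : Group H) (_ : Finite H) (n : ℕ → ℕ), StrictMono n ∧
        Filter.Tendsto (fun i => (commProb (G (n i)) : ℝ)) Filter.atTop
          (nhds (commProb H : ℝ)) ∧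
        ∀ i, commProb H ≤ commProb (G (n i))) ∧
    -- `S ∪ {0}` is closed
    IsClosed (commutingProbabilities ∪ {0}) ∧
    -- the three conjectures on a sequence in `S` with a positive limit
    (∀ (x : ℕ → ℝ) (l : ℝ), (∀ i, x i ∈ commutingProbabilities) → 0 < l →
      Filter.Tendsto x Filter.atTop (nhds l) →
      (∃ q : ℚ, l = (q : ℝ)) ∧
      (∀ᶠ i in Filter.atTop, l ≤ x i) ∧
      l ∈ commutingProbabilities) := by
  refine ⟨fun G _ _ hG => exists_subsequence_tendsto_commProb G hG,
    isClosed_commutingProbabilities_union_zero, fun x l hx hl hlim => ?_⟩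
  obtain ⟨H, hHg, hHf, heq, -⟩ := exists_commProb_eq_limit_of_mem hx hl hlim
  exact ⟨⟨commProb H, heq⟩, eventually_ge_limit_of_mem_commutingProbabilities hx hl hlim,
    H, hHg, hHf, heq⟩
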